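/- Let $m\ge 1$ be an integer. Let $\mathbb{TS}(\mathbb C^2,m+1)=\mathbb C^2\otimes \mathrm S^m(\mathbb C^2)$ be the space of tensors $\mathcal T=(t_{ii_1\dots i_m})$, $i,i_1,\dots,i_m\in\{1,2\}$, with complex entries that are symmetric in the last $m$ indices. For $\mathbf x\in\mathbb C^2$ let $\mathcal T\mathbf x^m\in\mathbb C^2$ be the vector with components $(\mathcal T\mathbf x^m)_i=\sum_{i_1,\dots,i_m}t_{ii_1\dots i_m}x_{i_1}\cdots x_{i_m}$. The eigenvalues of $\mathcal T$ are the numbers $\lambda\in\mathbb C$ with $(\mathcal T\mathbf x^m)_i=\lambda x_i^m$ $(i=1,2)$ for some $\mathbf x\neq 0$; they are the roots of the characteristic polynomial $\chi(\lambda)=\det(\lambda\mathcal I-\mathcal T)$, a monic polynomial of degree $2m$, where $\mathcal I$ is the identity tensor ($(\mathcal I\mathbf x^m)_i=x_i^m$) and the determinant of a tensor $\mathcal A$ is the resultant of the two binary forms $(\mathcal A\mathbf x^m)_1,(\mathcal A\mathbf x^m)_2$ of degree $m$. Let $\mathfrak S(2m)$ be the symmetric group on $2m$ letters, let $\mathbb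 C^{2m}/\mathfrak S(2m)$ be the set of multisets of $2m$ complex numbers, with the Zariski topology (the quotient of the Zariski topology of $\mathbb C^{2m}$), and let $$\phi:\mathbb{TS}(\mathbb C^2,m+1)\to\mathbb C^{2m}/\mathfrak S(2m)$$ send $\mathcal T$ to the multiset of its eigenvalues, counted with their multiplicities as roots of $\chi$. Then $\phi$ is dominant, that is, its image contains a Zariski open dense subset of $\mathbb C^{2m}/\mathfrak S(2m)$. In other words, for a generic multiset $S\in\mathbb C^{2m}/\mathfrak S(2m)$ (every $S$ outside some proper Zariski closed subset) there exists a tensor $\mathcal T\in\mathbb{TS}(\mathbb C^2,m+1)$ whose multiset of eigenvalues is $S$. -/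

import Mathlib

open Topology

/-- Tensors `T = (t_{i i₁ … i_m})` of order `m + 1` and dimension `n` with entries in `R`. -/
abbrev Tensor (R : Type) (n m : ℕ) : Type := Fin n → (Fin m → Fin n) → R

namespace Tensor

/-- The space `TS(Rⁿ, m + 1) = Rⁿ ⊗ Sᵐ(Rⁿ)`: the tensors all of whose slices
`T_i = (t_{i i₁ … i_m})_{i₁, …, i_m}` are symmetric. -/
def TS (R : Type) [CommRing R] (n m : ℕ) : Submodule R (Tensor R n m) where
  carrier := {T | ∀ (i : Fin n) (τ : Equiv.Perm (Fin m)) (j : Fin m → Fin n),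
    T i (j ∘ τ) = T i j}
  zero_mem' := fun _ _ _ => rfl
  add_mem' := fun {S T} hS hT i τ j => by
    change S i (j ∘ τ) + T i (j ∘ τ) = S i j + T i j
    rw [hS i τ j, hT i τ j]
  smul_mem' := fun c T hT i τ j => by
    change c • T i (j ∘ τ) = c • T i j
    rw [hT i τ j]

/-- The vector `T xᵐ`. -/
def apply {R : Type} [CommRing R] {n m : ℕ} (T : Tensor R n m) (x : Fin n → R) : Fin n → R :=
  fun i => ∑ j : Fin m → Fin n, T i j * ∏ k, x (j k)

/-- `μ` is an eigenvalue of `T`: `T xᵐ = μ x^{[m]}` for some nonzero vector `x`. -/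
def IsEigenvalue {n m : ℕ} (T : Tensor ℂ n m) (μ : ℂ) : Prop :=
  ∃ x : Fin n → ℂ, x ≠ 0 ∧ T.apply x = fun i => μ * x i ^ m

/-- The identity tensor: the entry `t_{i i₁ … i_m}` is `1` if `i₁ = … = i_m = i`, else `0`. -/
def identity (R : Type) [CommRing R] (n m : ℕ) : Tensor R n m :=
  fun i j => if ∀ k, j k = i then 1 else 0

/-- Entrywise application of a ring homomorphism. -/
def map {R S : Type} [CommRing R] [CommRing S] {n m : ℕ} (f : R →+* S) (T : Tensor R n m) :
    Tensor S n m :=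
  fun i j => f (T i j)

open Polynomial

/-- The `i`-th component of `T (z, 1)ᵐ` as a polynomial in `z`. For `n = 2`, its coefficient
of `zᵏ` is the coefficient of `xᵏ yᵐ⁻ᵏ` in the binary form `(T (x, y)ᵐ)_i` of degree `m`. -/
noncomputable def dehom {R : Type} [CommRing R] {m : ℕ} (T : Tensor R 2 m) (i : Fin 2) : R[X] :=
  (T.map C).apply ![X, 1] i

/-- The determinant of a two-dimensional tensor `T`: the resultant of the two binary forms
`(T xᵐ)_1`, `(T xᵐ)_2`, both of formal degree `m`. -/
noncomputable def det {R : Type} [CommRing R] {m : ℕ} (T : Tensor R 2 m) : R :=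
  (T.dehom 0).resultant (T.dehom 1) m m

/-- The characteristic polynomial `χ(λ) = det(λ I - T)`; the variable `λ` is `X`. -/
noncomputable def charpoly {m : ℕ} (T : Tensor ℂ 2 m) : ℂ[X] :=
  det ((X : ℂ[X]) • identity ℂ[X] 2 m - T.map C)

/-! Basic facts: the characteristic polynomial has degree `2m`, and its roots are exactly the
eigenvalues. -/

lemma map_apply {R S : Type} [CommRing R] [CommRing S] {n m : ℕ} (f : R →+* S)
    (T : Tensor R n m) (x : Fin n → R) (i : Fin n) :
    (T.map f).apply (fun k => f (x k)) i = f (T.apply x i) := by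
  simp [map, apply, map_sum, map_prod]

lemma identity_apply {R : Type} [CommRing R] {n m : ℕ} (x : Fin n → R) (i : Fin n) :
    (identity R n m).apply x i = x i ^ m := by
  rw [apply, Finset.sum_eq_single (fun _ => i)]
  · simp [identity]
  · intro j _ hj
    have : ¬ ∀ k, j k = i := fun h => hj (funext h)
    simp [identity, this]
  · simp

lemma smul_sub_apply {R : Type} [CommRing R] {n m : ℕ} (c : R) (T : Tensor R n m)
    (x : Fin n → R) (i : Fin n) :
    (c • identity R n m - T).apply x i = c * x i ^ m - T.apply x i := by
  rw [← identity_apply]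
  simp only [apply, Pi.sub_apply, Pi.smul_apply, smul_eq_mul, sub_mul, Finset.sum_sub_distrib,
    Finset.mul_sum, mul_assoc]

lemma natDegree_dehom_le {R : Type} [CommRing R] {m : ℕ} (T : Tensor R 2 m) (i : Fin 2) :
    (T.dehom i).natDegree ≤ m := by
  nontriviality R
  refine natDegree_sum_le_of_forall_le _ _ fun j _ => ?_
  refine (natDegree_C_mul_le _ _).trans ((natDegree_prod_le _ _).trans ?_)
  calc _ ≤ ∑ _k : Fin m, 1 := Finset.sum_le_sum fun k _ => by
        generalize j k = l
        fin_cases l <;> simp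
    _ = m := by simp

lemma dehom_map {R S : Type} [CommRing R] [CommRing S] {m : ℕ} (f : R →+* S) (T : Tensor R 2 m)
    (i : Fin 2) : (T.map f).dehom i = (T.dehom i).map f := by
  have h := map_apply (mapRingHom f) (T.map C) ![X, 1] i
  rw [coe_mapRingHom] at h
  rw [dehom, dehom, ← h]
  congr 1
  · funext i j; simp [map]
  · funext k; fin_cases k <;> simp

lemma det_map {R S : Type} [CommRing R] [CommRing S] {m : ℕ} (f : R →+* S) (T : Tensor R 2 m) :
    (T.map f).det = f T.det := by
  rw [det, det, dehom_map, dehom_map, resultant_map_map]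

lemma dehom_smul_sub {R : Type} [CommRing R] {m : ℕ} (c : R) (T : Tensor R 2 m) (i : Fin 2) :
    (c • identity R 2 m - T).dehom i = C c * (![X, 1] : Fin 2 → R[X]) i ^ m - T.dehom i := by
  rw [dehom, dehom, ← smul_sub_apply]
  congr 1
  funext i j
  simp [map, identity, apply_ite]

lemma charpoly_eq {m : ℕ} (T : Tensor ℂ 2 m) :
    T.charpoly = (sylvester (T.dehom 0) (T.dehom 1) m m).charpoly := by
  rw [charpoly, det, dehom_smul_sub, dehom_smul_sub, dehom_map, dehom_map, resultant,
    Matrix.charpoly]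
  congr 1
  ext1 i j
  rw [Matrix.charmatrix_apply]
  induction j using Fin.addCases with
  | left j =>
    simp only [sylvester, Matrix.of_apply, Fin.addCases_left, Matrix.diagonal_apply, Fin.ext_iff,
      Fin.val_castAdd, Set.mem_Icc]
    by_cases h : (j : ℕ) ≤ i ∧ (i : ℕ) ≤ j + m
    · by_cases hij : (i : ℕ) = j
      · simp [hij]
      · have : (i : ℕ) - j ≠ 0 := by omega
        simp [h, hij, coeff_C, this]
    · have : (i : ℕ) ≠ j := by omega
      simp [h, this]
  | right j =>
    simp only [sylvester, Matrix.of_apply, Fin.addCases_right, Matrix.diagonal_apply, Fin.ext_iff,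
      Fin.val_natAdd, Set.mem_Icc]
    by_cases h : (j : ℕ) ≤ i ∧ (i : ℕ) ≤ j + m
    · by_cases hij : (i : ℕ) = m + j
      · simp [hij, add_comm m]
      · have : (i : ℕ) - j ≠ m := by omega
        simp [h, hij, coeff_X_pow, this]
    · have : (i : ℕ) ≠ m + j := by omega
      simp [h, this]

lemma charpoly_monic {m : ℕ} (T : Tensor ℂ 2 m) : T.charpoly.Monic := by
  rw [charpoly_eq]
  exact Matrix.charpoly_monic _

lemma natDegree_charpoly {m : ℕ} (T : Tensor ℂ 2 m) : T.charpoly.natDegree = 2 * m := by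
  rw [charpoly_eq, Matrix.charpoly_natDegree_eq_dim, Fintype.card_fin, two_mul]

lemma eval_charpoly {m : ℕ} (T : Tensor ℂ 2 m) (μ : ℂ) :
    T.charpoly.eval μ = (μ • identity ℂ 2 m - T).det := by
  rw [charpoly, ← coe_evalRingHom, ← det_map]
  congr 1
  funext i j
  simp [map, identity, apply_ite]

lemma apply_smul {R : Type} [CommRing R] {n m : ℕ} (c : R) (T : Tensor R n m) (x : Fin n → R)
    (i : Fin n) : T.apply (fun k => c * x k) i = c ^ m * T.apply x i := by
  simp only [apply, Finset.prod_mul_distrib, Finset.prod_const, Finset.card_univ,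
    Fintype.card_fin, Finset.mul_sum]
  exact Finset.sum_congr rfl fun j _ => by ring

lemma eval_dehom {R : Type} [CommRing R] {m : ℕ} (T : Tensor R 2 m) (i : Fin 2) (r : R) :
    (T.dehom i).eval r = T.apply ![r, 1] i := by
  have h := map_apply (evalRingHom r) (T.map C) ![X, 1] i
  rw [coe_evalRingHom] at h
  rw [dehom, ← h]
  congr 1
  · funext i j; simp [map]
  · funext k; fin_cases k <;> simp

lemma coeff_dehom {R : Type} [CommRing R] {m : ℕ} (T : Tensor R 2 m) (i : Fin 2) :
    (T.dehom i).coeff m = T.apply ![1, 0] i := by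
  nontriviality R
  simp only [dehom, apply, finsetSum_coeff, map, coeff_C_mul]
  refine Finset.sum_congr rfl fun j _ => ?_
  congr 1
  by_cases h : ∀ k, j k = 0
  · simp [h]
  · push Not at h
    obtain ⟨k, hk⟩ := h
    have hk1 : j k = 1 := by omega
    rw [Finset.prod_eq_zero (f := fun k => (![1, 0] : Fin 2 → R) (j k)) (Finset.mem_univ k)
      (by simp [hk1])]
    refine coeff_eq_zero_of_natDegree_lt ((natDegree_prod_le _ _).trans_lt ?_)
    calc _ < ∑ _k : Fin m, 1 := Finset.sum_lt_sum (fun k _ => by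
            generalize j k = l
            fin_cases l <;> simp) ⟨k, Finset.mem_univ k, by simp [hk1]⟩
      _ = m := by simp

/-- The determinant vanishes exactly if the system `T xᵐ = 0` has a nonzero solution. -/
lemma det_eq_zero_iff {m : ℕ} (hm : 1 ≤ m) (T : Tensor ℂ 2 m) :
    T.det = 0 ↔ ∃ x : Fin 2 → ℂ, x ≠ 0 ∧ T.apply x = 0 := by
  have h0 := natDegree_dehom_le T 0
  have h1 := natDegree_dehom_le T 1
  constructor
  · intro h
    by_cases hc : (T.dehom 0).coeff m = 0 ∧ (T.dehom 1).coeff m = 0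
    · refine ⟨![1, 0], fun h => by simpa using congrFun h 0, funext fun i => ?_⟩
      rw [← coeff_dehom]
      fin_cases i
      exacts [hc.1, hc.2]
    · have key : ∀ f g : ℂ[X], f.natDegree ≤ m → g.natDegree ≤ m → f.coeff m ≠ 0 →
          f.resultant g m m = 0 → ¬ IsCoprime f g := by
        intro f g hf hg hfm hr
        have hf' : f.natDegree = m := le_antisymm hf (le_natDegree_of_ne_zero hfm)
        obtain ⟨k, hk⟩ := Nat.exists_eq_add_of_le hg
        have := resultant_add_right_deg f g m g.natDegree k le_rfl
        rw [← hk, hr] at this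
        have h2 : f.resultant g m g.natDegree = 0 := by
          rcases mul_eq_zero.mp this.symm with h | h
          · exact absurd h (pow_ne_zero _ hfm)
          · exact h
        rw [← hf'] at h2
        exact (resultant_eq_zero_iff.mp h2).2
      have hcop : ¬ IsCoprime (T.dehom 0) (T.dehom 1) := by
        by_cases hc0 : (T.dehom 0).coeff m = 0
        · have hc1 : (T.dehom 1).coeff m ≠ 0 := fun h => hc ⟨hc0, h⟩
          refine fun hco => key _ _ h1 h0 hc1 ?_ hco.symm
          rw [resultant_comm]
          rw [det] at h
          simp [h]
        · exact key _ _ h0 h1 hc0 h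
      have hne : T.dehom 0 ≠ 0 ∨ T.dehom 1 ≠ 0 := by
        by_contra hh
        push Not at hh
        exact hc (by simp [hh.1, hh.2])
      obtain ⟨r, hr0, hr1⟩ : ∃ r, (T.dehom 0).eval r = 0 ∧ (T.dehom 1).eval r = 0 := by
        by_contra hh
        push Not at hh
        refine hcop (isCoprime_of_dvd _ _ (fun hz => ?_) ?_)
        · rcases hne with h | h
          exacts [h hz.1, h hz.2]
        · intro z hz hz0 hd0 hd1
          have hdeg : z.degree ≠ 0 := fun hd => hz (isUnit_iff_degree_eq_zero.mpr hd)
          obtain ⟨r, hr⟩ := IsAlgClosed.exists_root z hdeg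
          exact hh r (eval_eq_zero_of_dvd_of_eval_eq_zero hd0 hr)
            (eval_eq_zero_of_dvd_of_eval_eq_zero hd1 hr)
      refine ⟨![r, 1], fun h => by simpa using congrFun h 1, funext fun i => ?_⟩
      rw [← eval_dehom]
      fin_cases i
      exacts [hr0, hr1]
  · rintro ⟨x, hx, hT⟩
    by_cases hx1 : x 1 = 0
    · have hx0 : x 0 ≠ 0 := fun h => hx (funext fun i => by fin_cases i <;> simpa)
      have hxe : x = fun k => x 0 * (![1, 0] : Fin 2 → ℂ) k :=
        funext fun i => by fin_cases i <;> simp [hx1]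
      have hc : ∀ i, (T.dehom i).coeff m = 0 := fun i => by
        have := congrFun hT i
        rw [hxe, apply_smul] at this
        rw [coeff_dehom]
        exact (mul_eq_zero.mp this).resolve_left (pow_ne_zero _ hx0)
      have hlt : ∀ i, (T.dehom i).natDegree < m := fun i => by
        refine lt_of_le_of_ne (natDegree_dehom_le T i) fun h => ?_
        have h2 : (T.dehom i).leadingCoeff = 0 := by rw [leadingCoeff, h, hc i]
        rw [leadingCoeff_eq_zero] at h2
        rw [h2, natDegree_zero] at h
        omega
      exact resultant_eq_zero_of_lt_lt _ _ _ _ (hlt 0) (hlt 1)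
    · have hxe : x = fun k => x 1 * (![x 0 / x 1, 1] : Fin 2 → ℂ) k :=
        funext fun i => by fin_cases i <;> simp [mul_div_cancel₀, hx1]
      have hc : ∀ i, (T.dehom i).eval (x 0 / x 1) = 0 := fun i => by
        have := congrFun hT i
        rw [hxe, apply_smul] at this
        rw [eval_dehom]
        exact (mul_eq_zero.mp this).resolve_left (pow_ne_zero _ hx1)
      obtain ⟨p, q, -, -, h⟩ := exists_mul_add_mul_eq_C_resultant (T.dehom 0) (T.dehom 1) h0 h1
        (Or.inl (by omega))
      have := congrArg (eval (x 0 / x 1)) h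
      simpa [hc, det] using this.symm

/-- The multiset `σ(T)` of eigenvalues of `T`, each counted with its algebraic multiplicity, that
is, its multiplicity as a root of the characteristic polynomial. -/
noncomputable def eigenvalues {m : ℕ} (T : Tensor ℂ 2 m) : Multiset ℂ :=
  T.charpoly.roots

/-- The elements of `σ(T)` are the eigenvalues of `T` in the sense of eigenvectors. -/
lemma mem_eigenvalues_iff {m : ℕ} (hm : 1 ≤ m) (T : Tensor ℂ 2 m) (μ : ℂ) :
    μ ∈ T.eigenvalues ↔ T.IsEigenvalue μ := by
  rw [eigenvalues, mem_roots T.charpoly_monic.ne_zero, IsRoot.def, eval_charpoly,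
    det_eq_zero_iff hm]
  refine exists_congr fun x => and_congr_right fun _ => ?_
  rw [funext_iff, funext_iff]
  refine forall_congr' fun i => ?_
  rw [smul_sub_apply, Pi.zero_apply, sub_eq_zero, eq_comm]

/-- The total multiplicity of `σ(T)` is `2m`. -/
lemma card_eigenvalues {m : ℕ} (T : Tensor ℂ 2 m) : Multiset.card T.eigenvalues = 2 * m := by
  rw [eigenvalues, ← natDegree_charpoly T]
  exact (splits_iff_card_roots.mp (IsAlgClosed.splits _))

end Tensor

open Tensor in
/-- The multiset-valued eigenvalue map `φ : TS(ℂ², m + 1) → ℂ²ᵐ / 𝔖(2m)`, `φ(T) = σ(T)`. The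
quotient `ℂᵈ / 𝔖(d)` is the type `Sym ℂ d` of multisets of `d` complex numbers. -/
noncomputable def eigenvalueMap (m : ℕ) (T : TS ℂ 2 m) : Sym ℂ (2 * m) :=
  ⟨eigenvalues (T : Tensor ℂ 2 m), card_eigenvalues _⟩

/-- The Zariski topology on `ℂᵈ`: the closed sets are the sets of common zeros of sets of
polynomials. -/
@[reducible] def zariskiTopology (d : ℕ) : TopologicalSpace (Fin d → ℂ) :=
  TopologicalSpace.ofClosed
    {Z | ∃ P : Set (MvPolynomial (Fin d) ℂ), Z = {x | ∀ p ∈ P, MvPolynomial.eval x p = 0}}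
    ⟨{1}, by simp⟩
    (fun A hA => ⟨{p | ∃ Z ∈ A, ∀ x ∈ Z, MvPolynomial.eval x p = 0}, by
      ext x
      simp only [Set.mem_sInter, Set.mem_ofPred_eq]
      refine ⟨fun h p ⟨Z, hZ, hp⟩ => hp x (h Z hZ), fun h Z hZ => ?_⟩
      obtain ⟨P, hP⟩ := hA hZ
      rw [hP]
      exact fun p hp => h p ⟨Z, hZ, fun y hy => by rw [hP] at hy; exact hy p hp⟩⟩)
    (fun Z₁ ⟨P₁, h₁⟩ Z₂ ⟨P₂, h₂⟩ => ⟨{p | ∃ p₁ ∈ P₁, ∃ p₂ ∈ P₂, p = p₁ * p₂}, by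
      ext x
      subst h₁ h₂
      simp only [Set.mem_union, Set.mem_ofPred_eq]
      constructor
      · rintro (h | h) _ ⟨p₁, hp₁, p₂, hp₂, rfl⟩
        · simp [h p₁ hp₁]
        · simp [h p₂ hp₂]
      · intro h
        by_contra hh
        push Not at hh
        obtain ⟨⟨p₁, hp₁, hn₁⟩, p₂, hp₂, hn₂⟩ := hh
        have := h _ ⟨p₁, hp₁, p₂, hp₂, rfl⟩
        rw [map_mul] at this
        exact mul_ne_zero hn₁ hn₂ this⟩)

/-- The quotient map `ℂᵈ → ℂᵈ / 𝔖(d)`, sending `(x₁, …, x_d)` to the multiset of its entries. -/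
def toSym (d : ℕ) (x : Fin d → ℂ) : Sym ℂ d :=
  ⟨Finset.univ.val.map x, by simp⟩

/-- The Zariski topology on `ℂᵈ / 𝔖(d)`, as the quotient of the Zariski topology on `ℂᵈ`. -/
@[reducible] def symZariskiTopology (d : ℕ) : TopologicalSpace (Sym ℂ d) :=
  (zariskiTopology d).coinduced (toSym d)

/-- A map into `ℂᵈ / 𝔖(d)` is dominant if its image contains a Zariski open dense subset. -/
def IsDominant {A : Type} {d : ℕ} (f : A → Sym ℂ d) : Prop :=
  ∃ U : Set (Sym ℂ d), IsOpen[symZariskiTopology d] U ∧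
    closure[symZariskiTopology d] U = Set.univ ∧ U ⊆ Set.range f

/-! Given `z` in ℂ²ᵐ, write `∏ j, (X - z j) = X ^ m * g - f` with `g` monic of degree `m` and `deg f
< m`. The tensor with dehomogenized components `f, g` sends `(z i, 1)` to `g(z i) * (z i ^ m, 1)`,
so each `g(z i)` (the `quotientValue`) is an eigenvalue. If these `2m` numbers are distinct, they
form the whole spectrum (`exists_eigenvalueMap_eq`).

It remains to see that the polynomial self-map `z ↦ (g(z i))_i` of ℂ²ᵐ is dominant. Its Jacobian is
invertible at the `2m`-th roots of unity, so its components are algebraically independent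
(`algebraicIndependent_quotientValue`). By Chevalley's theorem and the Nullstellensatz its image
contains the complement of a hypersurface (`exists_forall_exists_eval_eq`). Removing the points with
a repeated coordinate and passing to the quotient by the symmetric group gives the open dense set.
-/

namespace MvPolynomial

/-! ### Dominant polynomial maps: the Jacobian criterion and Chevalley's theorem. -/

theorem derivation_aeval {σ R : Type*} [Fintype σ] [CommSemiring R]
    (D : Derivation R (MvPolynomial σ R) (MvPolynomial σ R))
    (f : σ → MvPolynomial σ R) (P : MvPolynomial σ R) :
    D (aeval f P) = ∑ j, aeval f (pderiv j P) * D (f j) := by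
  classical
  induction P using MvPolynomial.induction_on with
  | C a => simp
  | add p q hp hq => simp only [map_add, hp, hq, add_mul, Finset.sum_add_distrib]
  | mul_X p i hp =>
    have h : ∀ j, aeval f (pderiv j (p * X i)) * D (f j) =
        (if i = j then aeval f p * D (f j) else 0) + f i * (aeval f (pderiv j p) * D (f j)) := by
      intro j
      rw [Derivation.leibniz, pderiv_X, Pi.single_apply]
      split_ifs <;> simp only [smul_eq_mul, map_add, map_mul, aeval_X, map_one, map_zero] <;> ring
    rw [Finset.sum_congr rfl fun j _ => h j, Finset.sum_add_distrib, ← Finset.mul_sum, ← hp,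
      Finset.sum_ite_eq, if_pos (Finset.mem_univ i), map_mul, aeval_X, Derivation.leibniz,
      smul_eq_mul, smul_eq_mul]

/-- An exponent `s` with `s j ≠ 0` contributes `s j` times its coefficient to `pderiv j P`, and `s
j` is invertible in characteristic zero. -/
theorem eq_C_of_pderiv_eq_zero {σ K : Type*} [Field K] [CharZero K] (P : MvPolynomial σ K)
    (h : ∀ j, pderiv j P = 0) :
    P = C (constantCoeff P) := by
  classical
  ext s
  rw [coeff_C]
  split_ifs with hs
  · rw [← hs, constantCoeff_eq]
  · obtain ⟨j, hj⟩ : ∃ j, s j ≠ 0 := by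
      by_contra hh
      push Not at hh
      exact hs (Finsupp.ext hh).symm
    have := congrArg (coeff (s - Finsupp.single j 1)) (h j)
    rw [coeff_pderiv, coeff_zero] at this
    have hle : Finsupp.single j 1 ≤ s := by
      rw [Finsupp.single_le_iff]; omega
    rw [tsub_add_cancel_of_le hle] at this
    exact (mul_eq_zero.mp this).resolve_right (Nat.cast_add_one_ne_zero _)

theorem totalDegree_pderiv_lt {σ R : Type*} [CommSemiring R] {P : MvPolynomial σ R} {j : σ}
    (h : pderiv j P ≠ 0) :
    (pderiv j P).totalDegree < P.totalDegree := by
  classical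
  obtain ⟨s, hs, hd⟩ := Finset.exists_mem_eq_sup _ (support_nonempty.mpr h)
    fun s : σ →₀ ℕ => s.sum fun _ e => e
  rw [← totalDegree] at hd
  have h1 : coeff (s + Finsupp.single j 1) P ≠ 0 := by
    intro h0
    rw [mem_support_iff, coeff_pderiv, h0, zero_mul] at hs
    exact hs rfl
  have := le_totalDegree (mem_support_iff.mpr h1)
  rw [Finsupp.sum_add_index' (fun _ => rfl) (fun _ _ _ => rfl), Finsupp.sum_single_index rfl] at this
  omega

/-- The Jacobian criterion for algebraic independence. -/
theorem algebraicIndependent_of_injective_jacobian {σ K : Type*} [Fintype σ] [Field K] [CharZero K]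
    (f : σ → MvPolynomial σ K) (z : σ → K)
    (h : ∀ v : σ → K, (∀ j, ∑ i, v i * eval z (pderiv i (f j)) = 0) → v = 0) :
    AlgebraicIndependent K f := by
  classical
  have hdet : (Matrix.of fun i j => pderiv i (f j)).det ≠ 0 := by
    intro h0
    have h1 := congrArg (eval z) h0
    rw [RingHom.map_det, map_zero] at h1
    obtain ⟨v, hv, hv0⟩ := Matrix.exists_vecMul_eq_zero_iff.mpr h1
    refine hv (h v fun j => ?_)
    simpa [Matrix.vecMul, dotProduct] using congrFun hv0 j
  rw [algebraicIndependent_iff]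
  intro P
  -- Differentiating a relation `P` gives a linear system for the `aeval f (pderiv j P)` whose
  -- matrix is the Jacobian. Hence each partial derivative of `P` is again a relation, of smaller
  -- degree if nonzero.
  induction hn : P.totalDegree using Nat.strong_induction_on generalizing P with
  | _ n ih =>
    intro hP
    have hd : ∀ j, aeval f (pderiv j P) = 0 := by
      have := Matrix.eq_zero_of_mulVec_eq_zero hdet (v := fun j => aeval f (pderiv j P)) (by
        funext i
        have := derivation_aeval (pderiv i) f P
        rw [hP, map_zero] at this
        rw [Pi.zero_apply, this, Matrix.mulVec, dotProduct]
        exact Finset.sum_congr rfl fun j _ => mul_comm _ _)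
      exact congrFun this
    have hp : ∀ j, pderiv j P = 0 := by
      intro j
      by_contra hj
      exact hj (ih _ (hn ▸ totalDegree_pderiv_lt hj) _ rfl (hd j))
    have hC := eq_C_of_pderiv_eq_zero P hp
    rw [hC, aeval_C, algebraMap_eq] at hP
    rw [hC, hP]

/-- A dominant polynomial map between affine spaces over an algebraically closed field hits every
point outside a proper hypersurface. -/
theorem exists_forall_exists_eval_eq {σ τ K : Type*} [Finite σ] [Finite τ] [Field K]
    [IsAlgClosed K] {f : τ → MvPolynomial σ K}
    (hf : AlgebraicIndependent K f) :
    ∃ a : MvPolynomial τ K, a ≠ 0 ∧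
      ∀ y : τ → K, eval y a ≠ 0 → ∃ z : σ → K, ∀ j, eval z (f j) = y j := by
  let φ : MvPolynomial τ K →ₐ[K] MvPolynomial σ K := aeval f
  have hφ : Function.Injective φ := hf
  have hfp : φ.FinitePresentation := by
    refine AlgHom.FinitePresentation.of_comp_finiteType (Algebra.ofId K _) (g := φ) ?_ ?_
    · rw [Subsingleton.elim (φ.comp (Algebra.ofId K _)) (Algebra.ofId K _)]
      exact RingHom.finitePresentation_algebraMap.mpr inferInstance
    · exact RingHom.finiteType_algebraMap.mpr inferInstance
  obtain ⟨S, hS⟩ := PrimeSpectrum.exists_constructibleSetData_iff.mpr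
    (PrimeSpectrum.isConstructible_range_comap (f := φ.toRingHom) hfp)
  -- Injectivity of `φ` puts the generic point in the image, so some constructible piece `V(g) ∩
  -- D(f)` contains it. This forces `g = 0`, and the piece is a nonempty basic open set.
  have hbot : (⊥ : PrimeSpectrum (MvPolynomial τ K)) ∈ S.toSet := by
    rw [hS]
    refine ⟨⊥, PrimeSpectrum.ext ?_⟩
    exact (RingHom.injective_iff_ker_eq_bot φ.toRingHom).mp hφ
  simp only [PrimeSpectrum.ConstructibleSetData.toSet, Set.mem_iUnion] at hbot
  obtain ⟨B, hB, hg, ha⟩ := hbot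
  have hg0 : ∀ i, B.g i = 0 := fun i => hg ⟨i, rfl⟩
  refine ⟨B.f, fun h => ha (by simp [h]), fun y hy => ?_⟩
  let p : PrimeSpectrum (MvPolynomial τ K) := ⟨RingHom.ker (eval y), RingHom.ker_isPrime _⟩
  have hp : p ∈ Set.range (PrimeSpectrum.comap φ.toRingHom) := by
    rw [← hS]
    refine Set.mem_biUnion hB ⟨?_, ?_⟩
    · rintro _ ⟨i, rfl⟩
      rw [hg0]
      exact p.asIdeal.zero_mem
    · intro h
      exact hy (h rfl)
  obtain ⟨q, hq⟩ := hp
  -- A prime over the point `y` need not be maximal. Any maximal ideal above it still contains `φ (X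
  -- j - C (y j))`, and by the Nullstellensatz it is a point `z`.
  obtain ⟨M, hM, hqM⟩ := Ideal.exists_le_maximal q.asIdeal q.2.ne_top
  obtain ⟨z, rfl⟩ := isMaximal_iff_eq_vanishingIdeal_singleton.mp hM
  refine ⟨z, fun j => ?_⟩
  have h1 : X j - C (y j) ∈ p.asIdeal := by
    change eval y _ = 0
    simp
  rw [← hq] at h1
  have h2 := hqM (show φ (X j - C (y j)) ∈ q.asIdeal from h1)
  simpa [φ, sub_eq_zero] using h2

end MvPolynomial

/-! The eigenvalue parametrization by the roots of `z ^ m * g - f`. -/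

namespace Tensor
open Polynomial

/-- The monic polynomial with roots `z i`. -/
noncomputable def rootPoly {R : Type*} [CommRing R] {n : ℕ} (z : Fin n → R) : R[X] :=
  ∏ j, (X - C (z j))

lemma rootPoly_monic {R : Type*} [CommRing R] {n : ℕ} (z : Fin n → R) : (rootPoly z).Monic :=
  monic_prod_of_monic _ _ fun _ _ => monic_X_sub_C _

lemma natDegree_rootPoly {R : Type*} [CommRing R] [Nontrivial R] {n : ℕ} (z : Fin n → R) :
    (rootPoly z).natDegree = n := by
  rw [rootPoly, natDegree_prod_of_monic _ _ fun _ _ => monic_X_sub_C _]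
  simp

lemma eval_rootPoly {R : Type*} [CommRing R] {n : ℕ} (z : Fin n → R) (i : Fin n) :
    (rootPoly z).eval (z i) = 0 := by
  rw [rootPoly, eval_prod]
  exact Finset.prod_eq_zero (Finset.mem_univ i) (by simp)

lemma rootPoly_map {R S : Type*} [CommRing R] [CommRing S] (φ : R →+* S) {n : ℕ} (z : Fin n → R) :
    (rootPoly z).map φ = rootPoly fun i => φ (z i) := by
  simp [rootPoly, Polynomial.map_prod]

lemma sum_coeff_rootPoly {R : Type*} [CommRing R] [Nontrivial R] {n : ℕ} (z : Fin n → R) (i : Fin n) :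
    ∑ k ∈ Finset.range (n + 1), (rootPoly z).coeff k * z i ^ k = 0 := by
  rw [← eval_eq_sum_range' (by rw [natDegree_rootPoly]; omega), eval_rootPoly]

lemma coeff_rootPoly_self {R : Type*} [CommRing R] [Nontrivial R] {n : ℕ} (z : Fin n → R) :
    (rootPoly z).coeff n = 1 := by
  have := (rootPoly_monic z).coeff_natDegree
  rwa [natDegree_rootPoly] at this

/-- The value at `z i` of the quotient of `∏ j, (X - z j)` by `X ^ m`. -/
noncomputable def quotientValue {R : Type*} [CommRing R] (m : ℕ) (z : Fin (2 * m) → R)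
    (i : Fin (2 * m)) : R :=
  ∑ k ∈ Finset.range (m + 1), (rootPoly z).coeff (m + k) * z i ^ k

lemma map_quotientValue {R S : Type*} [CommRing R] [CommRing S] (φ : R →+* S) (m : ℕ)
    (z : Fin (2 * m) → R) (i : Fin (2 * m)) :
    φ (quotientValue m z i) = quotientValue m (fun i => φ (z i)) i := by
  simp [quotientValue, ← rootPoly_map]

/-- Supplies the base point for the Jacobian: at the roots of unity all coefficients but two vanish,
and the roots are simple and nonzero. -/
lemma exists_rootPoly_eq (n : ℕ) (hn : n ≠ 0) :
    ∃ z : Fin n → ℂ, Function.Injective z ∧ (∀ i, z i ^ n = 1) ∧ rootPoly z = X ^ n - 1 := by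
  have hζ := Complex.isPrimitiveRoot_exp n hn
  set ζ := Complex.exp (2 * Real.pi * Complex.I / n)
  have hinj : Function.Injective fun i : Fin n => ζ ^ (i : ℕ) := fun i j h =>
    Fin.ext (hζ.pow_inj i.2 j.2 h)
  have hone : ∀ i : Fin n, (ζ ^ (i : ℕ)) ^ n = 1 := fun i => by
    rw [← pow_mul, mul_comm, pow_mul, hζ.pow_eq_one, one_pow]
  refine ⟨_, hinj, hone, ?_⟩
  refine eq_of_degree_sub_lt_of_eval_index_eq Finset.univ hinj.injOn ?_ fun i _ => ?_
  · have hm := rootPoly_monic fun i : Fin n => ζ ^ (i : ℕ)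
    refine (degree_sub_lt_left ?_ hm.ne_zero ?_).trans_eq ?_
    · rw [degree_eq_natDegree hm.ne_zero, natDegree_rootPoly, ← C_1, degree_X_pow_sub_C (by omega)]
    · rw [hm.leadingCoeff, ← C_1, leadingCoeff_X_pow_sub_C (by omega)]
    · rw [degree_eq_natDegree hm.ne_zero, natDegree_rootPoly]
      simp
  · rw [eval_rootPoly fun i : Fin n => ζ ^ (i : ℕ)]
    simp [hone]

/-- The quotient values of the generic point are algebraically independent. -/
theorem algebraicIndependent_quotientValue (m : ℕ) (hm : 1 ≤ m) :
    AlgebraicIndependent ℂ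
      (quotientValue m (MvPolynomial.X : Fin (2 * m) → MvPolynomial (Fin (2 * m)) ℂ)) := by
  obtain ⟨z, hinj, hone, hz⟩ := exists_rootPoly_eq (2 * m) (by omega)
  refine MvPolynomial.algebraicIndependent_of_injective_jacobian _ z fun v hv => ?_
  set D := rootPoly (MvPolynomial.X : Fin (2 * m) → MvPolynomial (Fin (2 * m)) ℂ) with hD
  have hDz : ∀ k, MvPolynomial.eval z (D.coeff k) = (X ^ (2 * m) - 1 : ℂ[X]).coeff k := by
    intro k
    rw [← coeff_map, rootPoly_map]
    simp [hz]
  -- The derivative in the direction of a vector `v` in the kernel of the Jacobian; the aim is `v =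
  -- 0`.
  let Δ : Derivation ℂ (MvPolynomial (Fin (2 * m)) ℂ) (MvPolynomial (Fin (2 * m)) ℂ) :=
    ∑ i, v i • MvPolynomial.pderiv i
  have hΔ : ∀ p, MvPolynomial.eval z (Δ p) =
      ∑ i, v i * MvPolynomial.eval z (MvPolynomial.pderiv i p) := by
    intro p
    rw [← Derivation.coeFnAddMonoidHom_apply, map_sum, Finset.sum_apply, map_sum]
    simp
  have hΔX : ∀ i, MvPolynomial.eval z (Δ (MvPolynomial.X i)) = v i := by
    intro i
    simp [hΔ, MvPolynomial.pderiv_X, Pi.single_apply, apply_ite]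
  let E : ℕ → ℂ := fun k => MvPolynomial.eval z (Δ (D.coeff k))
  have hterm : ∀ (k l : ℕ) (i : Fin (2 * m)), MvPolynomial.eval z (Δ (D.coeff k * MvPolynomial.X i ^ l)) =
      E k * z i ^ l + (X ^ (2 * m) - 1 : ℂ[X]).coeff k * (l * z i ^ (l - 1) * v i) := by
    intro k l i
    rw [Derivation.leibniz, Derivation.leibniz_pow]
    simp only [smul_eq_mul, nsmul_eq_mul, map_add, map_mul, map_pow, MvPolynomial.eval_X, hDz, hΔX,
      map_natCast, E]
    ring
  have hE : E (2 * m) = 0 := by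
    simp only [E, hD, coeff_rootPoly_self, Derivation.map_one_eq_zero, map_zero]
  have hcoeff : ∀ k, k ≠ 0 → k < 2 * m → (X ^ (2 * m) - 1 : ℂ[X]).coeff k = 0 := by
    intro k h0 hk
    simp [coeff_X_pow, coeff_one, h0, hk.ne]
  have hlead : (X ^ (2 * m) - 1 : ℂ[X]).coeff (2 * m) = 1 := by
    rw [← hz, coeff_rootPoly_self]
  -- The derivative along `v` of the identity `D(z i) = 0`; at the base point `D = X ^ (2 * m) - 1`.
  have hroot : ∀ i, ∑ k ∈ Finset.range (2 * m), E k * z i ^ k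
      + 2 * m * z i ^ (2 * m - 1) * v i = 0 := by
    intro i
    have h := congrArg (fun p => MvPolynomial.eval z (Δ p))
      (sum_coeff_rootPoly (MvPolynomial.X : Fin (2 * m) → MvPolynomial (Fin (2 * m)) ℂ) i)
    simp only [map_sum, map_zero, ← hD, hterm] at h
    rw [Finset.sum_range_succ, hE, hlead, Finset.sum_congr rfl (g := fun k => E k * z i ^ k)] at h
    · push_cast at h
      linear_combination h
    · intro k hk
      rcases eq_or_ne k 0 with rfl | h0
      · simp
      · rw [hcoeff k h0 (Finset.mem_range.mp hk)]
        ring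
  -- The vanishing derivative of `g(z i)`; at the base point `g = X ^ m`.
  have hval : ∀ i, ∑ k ∈ Finset.range m, E (m + k) * z i ^ k + m * z i ^ (m - 1) * v i = 0 := by
    intro i
    have h := hv i
    rw [← hΔ, quotientValue] at h
    simp only [map_sum, ← hD, hterm] at h
    rw [Finset.sum_range_succ, ← two_mul, hE, hlead,
      Finset.sum_congr rfl (g := fun k => E (m + k) * z i ^ k)] at h
    · linear_combination h
    · intro k hk
      rw [hcoeff (m + k) (by omega) (by have := Finset.mem_range.mp hk; omega)]
      ring
  -- With `f', g'` the variations of `f, g`, this is `Q = X ^ m * g' + f'`. Eliminating `v i`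
  -- between `hroot` and `hval` gives `Q(z i) = 0` at `2m` distinct points, while `deg Q < 2m`.
  let Q : ℂ[X] := ∑ k ∈ Finset.range (2 * m), C (if k < m then -E k else E k) * X ^ k
  have hQ : Q = 0 := by
    refine eq_zero_of_degree_lt_of_eval_index_eq_zero Finset.univ hinj.injOn ?_ fun i _ => ?_
    · refine (degree_sum_le _ _).trans_lt ((Finset.sup_lt_iff ?_).mpr fun k hk => ?_)
      · exact WithBot.bot_lt_coe (Finset.univ : Finset (Fin (2 * m))).card
      · refine (degree_C_mul_X_pow_le _ _).trans_lt ?_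
        rw [Finset.card_univ, Fintype.card_fin]
        exact Nat.cast_lt.mpr (Finset.mem_range.mp hk)
    · have h1 := hroot i
      have h2 := hval i
      have hs : ∀ F : ℕ → ℂ, ∑ k ∈ Finset.range (2 * m), F k =
          ∑ k ∈ Finset.range m, F k + ∑ k ∈ Finset.range m, F (m + k) := fun F => by
        rw [two_mul, Finset.sum_range_add]
      have h3 : ∑ k ∈ Finset.range m, E (m + k) * z i ^ (m + k) =
          z i ^ m * ∑ k ∈ Finset.range m, E (m + k) * z i ^ k := by
        rw [Finset.mul_sum]
        exact Finset.sum_congr rfl fun k _ => by ring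
      have h4 : z i ^ (2 * m - 1) = z i ^ m * z i ^ (m - 1) := by
        rw [← pow_add]
        congr 1
        omega
      rw [hs, h3, h4] at h1
      simp only [Q, eval_finsetSum, eval_mul, eval_C, eval_pow, eval_X]
      rw [hs, Finset.sum_congr rfl (g := fun k => - (E k * z i ^ k)),
        Finset.sum_congr (s₁ := Finset.range m) rfl
        (f := fun k => (if m + k < m then -E (m + k) else E (m + k)) * z i ^ (m + k))
        (g := fun k => E (m + k) * z i ^ (m + k)), h3, Finset.sum_neg_distrib]
      · linear_combination -h1 + 2 * z i ^ m * h2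
      · intro k _
        simp
      · intro k hk
        simp [Finset.mem_range.mp hk]
  have hE0 : ∀ k < 2 * m, E k = 0 := by
    intro k hk
    have := congrArg (fun q => coeff q k) hQ
    simp only [Q, finsetSum_coeff, coeff_C_mul_X_pow, Finset.sum_ite_eq, Finset.mem_range, hk,
      if_true, coeff_zero] at this
    split_ifs at this
    · exact neg_eq_zero.mp this
    · exact this
  funext i
  have h := hroot i
  rw [Finset.sum_eq_zero fun k hk => by rw [hE0 k (Finset.mem_range.mp hk), zero_mul], zero_add] at h
  have hz0 : z i ≠ 0 := fun h0 => by
    have := hone i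
    rw [h0, zero_pow (by omega)] at this
    exact zero_ne_one this
  refine (mul_eq_zero.mp h).resolve_left (mul_ne_zero ?_ (pow_ne_zero _ hz0))
  exact_mod_cast (by omega : 2 * m ≠ 0)

/-! ### Realizing distinct quotient values as a spectrum. -/

/-- The symmetric tensor whose dehomogenized components have coefficients `c`. -/
noncomputable def ofCoeff (m : ℕ) (c : Fin 2 → ℕ → ℂ) : TS ℂ 2 m :=
  -- Exactly `m.choose k` multi-indices have `k` entries equal to `0`, and all contribute to the
  -- coefficient of `x ^ k`.
  ⟨fun i j => c i (Finset.univ.filter fun k => j k = 0).card /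
      m.choose (Finset.univ.filter fun k => j k = 0).card, fun i τ j => by
    have : (Finset.univ.filter fun k => (j ∘ τ) k = 0).card =
        (Finset.univ.filter fun k => j k = 0).card :=
      Finset.card_equiv τ fun k => by simp
    simp only [this]⟩

lemma ofCoeff_apply (m : ℕ) (c : Fin 2 → ℕ → ℂ) (x : ℂ) (i : Fin 2) :
    (ofCoeff m c : Tensor ℂ 2 m).apply ![x, 1] i = ∑ k ∈ Finset.range (m + 1), c i k * x ^ k := by
  let e : (Fin m → Fin 2) ≃ Finset (Fin m) :=
    { toFun := fun j => Finset.univ.filter fun k => j k = 0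
      invFun := fun s k => if k ∈ s then 0 else 1
      left_inv := fun j => funext fun k => by
        simp only [Finset.mem_filter, Finset.mem_univ, true_and]
        split_ifs <;> omega
      right_inv := fun s => by ext k; simp }
  have h := Finset.sum_powerset_apply_card (fun k => c i k / m.choose k * x ^ k)
    (x := (Finset.univ : Finset (Fin m)))
  rw [Finset.powerset_univ, Finset.card_univ, Fintype.card_fin] at h
  rw [apply, Fintype.sum_equiv e _ (fun s => c i s.card / m.choose s.card * x ^ s.card), h]
  · refine Finset.sum_congr rfl fun k hk => ?_
    have : (m.choose k : ℂ) ≠ 0 := by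
      exact_mod_cast (Nat.choose_pos (by have := Finset.mem_range.mp hk; omega)).ne'
    rw [nsmul_eq_mul]
    field_simp
  · intro j
    have hp : ∀ k, (![x, 1] : Fin 2 → ℂ) (j k) = if j k = 0 then x else 1 := by
      intro k
      generalize j k = l
      fin_cases l <;> simp
    simp only [hp, Finset.prod_ite, Finset.prod_const, one_pow, mul_one]
    rfl

/-- If distinct numbers are the quotient values of `z`, they are the eigenvalues of a tensor. -/
theorem exists_eigenvalueMap_eq (m : ℕ) (hm : 1 ≤ m) (z : Fin (2 * m) → ℂ)
    (hinj : Function.Injective (quotientValue m z)) :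
    ∃ T : TS ℂ 2 m, eigenvalueMap m T = toSym (2 * m) (quotientValue m z) := by
  let T := ofCoeff m ![fun k => if k < m then -(rootPoly z).coeff k else 0,
    fun k => (rootPoly z).coeff (m + k)]
  refine ⟨T, Subtype.ext (Eq.symm ?_)⟩
  -- Since the values are distinct, inclusion as sets is inclusion of multisets, and both have `2m`
  -- elements. Multiplicities in the characteristic polynomial need no computation.
  refine Multiset.eq_of_le_of_card_le ?_ ?_
  · refine (Multiset.le_iff_subset
      ((Multiset.nodup_map_iff_of_injective hinj).mpr Finset.univ.nodup)).mpr ?_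
    intro μ hμ
    obtain ⟨i, -, rfl⟩ := Multiset.mem_map.mp hμ
    refine (mem_eigenvalues_iff hm _ _).mpr ⟨![z i, 1], fun h => by simpa using congrFun h 1, ?_⟩
    funext l
    rw [ofCoeff_apply]
    have h := sum_coeff_rootPoly z i
    fin_cases l
    · have h2 : Finset.range (2 * m + 1) = Finset.range (m + (m + 1)) := by congr 1; omega
      rw [h2, Finset.sum_range_add] at h
      have h3 : ∑ k ∈ Finset.range (m + 1), (rootPoly z).coeff (m + k) * z i ^ (m + k) =
          quotientValue m z i * z i ^ m := by
        rw [quotientValue, Finset.sum_mul]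
        exact Finset.sum_congr rfl fun k _ => by ring
      rw [h3] at h
      simp only [Fin.zero_eta, Matrix.cons_val_zero]
      rw [Finset.sum_range_succ, Finset.sum_congr rfl
        (g := fun k => -((rootPoly z).coeff k * z i ^ k)), Finset.sum_neg_distrib]
      · simp only [lt_irrefl, if_false]
        linear_combination -h
      · intro k hk
        simp [Finset.mem_range.mp hk]
    · simp [quotientValue]
  · exact (eigenvalueMap m T).2.le.trans (toSym (2 * m) (quotientValue m z)).2.ge

end Tensor

/-! ### Zariski open sets in the quotient by the symmetric group. -/

lemma isOpen_zariski_exists_ne_zero {d : ℕ} (P : Set (MvPolynomial (Fin d) ℂ)) :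
    IsOpen[zariskiTopology d] {x | ∃ p ∈ P, MvPolynomial.eval x p ≠ 0} := by
  refine ⟨P, ?_⟩
  ext x
  simp

lemma exists_basicOpen_subset {d : ℕ} {V : Set (Fin d → ℂ)} (hV : IsOpen[zariskiTopology d] V)
    (hne : V.Nonempty) :
    ∃ p : MvPolynomial (Fin d) ℂ, p ≠ 0 ∧ ∀ x, MvPolynomial.eval x p ≠ 0 → x ∈ V := by
  obtain ⟨P, hP⟩ : ∃ P : Set (MvPolynomial (Fin d) ℂ),
    Vᶜ = {x | ∀ p ∈ P, MvPolynomial.eval x p = 0} := hV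
  obtain ⟨y, hy⟩ := hne
  have hy' : y ∉ Vᶜ := fun h => h hy
  rw [hP] at hy'
  obtain ⟨p, hp, hpy⟩ : ∃ p ∈ P, MvPolynomial.eval y p ≠ 0 := by
    by_contra! hh
    exact hy' hh
  refine ⟨p, fun h => hpy (by simp [h]), fun x hx => ?_⟩
  by_contra hxV
  have : x ∈ Vᶜ := hxV
  rw [hP] at this
  exact hx (this p hp)

lemma exists_eval_ne_zero {d : ℕ} {p : MvPolynomial (Fin d) ℂ} (hp : p ≠ 0) :
    ∃ x, MvPolynomial.eval x p ≠ 0 := by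
  by_contra! h
  exact hp (MvPolynomial.funext fun x => by rw [h, map_zero])

/-- Equal multiplicities make the fibres of `x` and `y` over each value equinumerous; bijections
between fibres glue to a permutation. -/
lemma toSym_eq_iff {d : ℕ} (x y : Fin d → ℂ) :
    toSym d x = toSym d y ↔ ∃ τ : Equiv.Perm (Fin d), x = y ∘ τ := by
  constructor
  · intro h
    have hc : ∀ c, Nonempty ({i // x i = c} ≃ {i // y i = c}) := fun c => by
      rw [← Fintype.card_eq, Fintype.card_subtype, Fintype.card_subtype]
      have := congrArg (Multiset.count c) (Subtype.ext_iff.mp h)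
      simp only [toSym, Multiset.count_map, eq_comm (a := c)] at this
      exact this
    let e c := (hc c).some
    exact ⟨Equiv.ofFiberEquiv e, funext fun i => (Equiv.ofFiberEquiv_map e i).symm⟩
  · rintro ⟨τ, rfl⟩
    refine Subtype.ext ?_
    change Finset.univ.val.map (y ∘ τ) = Finset.univ.val.map y
    rw [← Multiset.map_map, Multiset.map_univ_val_equiv]

lemma toSym_surjective (d : ℕ) : Function.Surjective (toSym d) := by
  rintro ⟨s, hs⟩
  obtain ⟨l, rfl⟩ := Quotient.exists_rep s
  obtain rfl : l.length = d := hs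
  refine ⟨l.get, Subtype.ext ?_⟩
  change Finset.univ.val.map l.get = _
  rw [Fin.univ_val_map, List.ofFn_get]
  rfl

theorem exists_isOpen_dense_subset {d : ℕ} {b : MvPolynomial (Fin d) ℂ} (hb : b ≠ 0)
    {R : Set (Sym ℂ d)} (hR : ∀ x, MvPolynomial.eval x b ≠ 0 → toSym d x ∈ R) :
    ∃ U : Set (Sym ℂ d), IsOpen[symZariskiTopology d] U ∧
      closure[symZariskiTopology d] U = Set.univ ∧ U ⊆ R ∧ U.Nonempty := by
  refine ⟨toSym d '' {x | MvPolynomial.eval x b ≠ 0}, ?_, ?_, ?_, ?_⟩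
  -- The preimage of the image is the union of the nonvanishing loci of all permuted copies of `b`.
  · rw [isOpen_coinduced]
    convert isOpen_zariski_exists_ne_zero
      (Set.range fun τ : Equiv.Perm (Fin d) => MvPolynomial.rename τ b) using 1
    ext x
    simp only [Set.mem_preimage, Set.mem_image, Set.mem_ofPred_eq, Set.exists_range_iff,
      MvPolynomial.eval_rename, toSym_eq_iff]
    constructor
    · rintro ⟨_, hy, τ, rfl⟩
      exact ⟨τ, hy⟩
    · rintro ⟨τ, hy⟩
      exact ⟨_, hy, τ, rfl⟩
  · let := symZariskiTopology d
    rw [← dense_iff_closure_eq, dense_iff_inter_open]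
    rintro V hV ⟨S, hS⟩
    obtain ⟨y, rfl⟩ : ∃ y, toSym d y = S := toSym_surjective d S
    obtain ⟨p, hp0, hp⟩ := exists_basicOpen_subset (isOpen_coinduced.mp hV) ⟨y, hS⟩
    -- Density is irreducibility of affine space: `p * b` is nonzero, so it is nonzero at some
    -- point.
    obtain ⟨x, hx⟩ := exists_eval_ne_zero (mul_ne_zero hp0 hb)
    rw [map_mul] at hx
    exact ⟨toSym d x, hp x (left_ne_zero_of_mul hx), x, right_ne_zero_of_mul hx, rfl⟩
  · rintro _ ⟨x, hx, rfl⟩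
    exact hR x hx
  · obtain ⟨x, hx⟩ := exists_eval_ne_zero hb
    exact ⟨_, x, hx, rfl⟩

theorem proposition3p5 (m : ℕ) (hm : 1 ≤ m) :
    IsDominant (eigenvalueMap m) ∧
      ∃ Z : Set (Sym ℂ (2 * m)), IsClosed[symZariskiTopology (2 * m)] Z ∧ Z ≠ Set.univ ∧
        ∀ S : Sym ℂ (2 * m), S ∉ Z → ∃ T : Tensor.TS ℂ 2 m, eigenvalueMap m T = S := by
  obtain ⟨a, ha0, ha⟩ := MvPolynomial.exists_forall_exists_eval_eq
    (Tensor.algebraicIndependent_quotientValue m hm)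
  -- Nonvanishing of this polynomial in the target coordinates makes the prescribed eigenvalues
  -- distinct.
  let disc : MvPolynomial (Fin (2 * m)) ℂ :=
    ∏ i, ∏ j ∈ Finset.univ.erase i, (MvPolynomial.X i - MvPolynomial.X j)
  have hdisc : disc ≠ 0 := by
    refine Finset.prod_ne_zero_iff.mpr fun i _ => Finset.prod_ne_zero_iff.mpr fun j hj => ?_
    rw [sub_ne_zero]
    exact fun h => Finset.ne_of_mem_erase hj (MvPolynomial.X_injective h).symm
  obtain ⟨U, hUo, hUd, hUs, hUn⟩ := exists_isOpen_dense_subset (mul_ne_zero ha0 hdisc)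
    (R := Set.range (eigenvalueMap m)) fun x hx => by
      rw [map_mul] at hx
      obtain ⟨z, hz⟩ := ha x (left_ne_zero_of_mul hx)
      have hzx : Tensor.quotientValue m z = x := by
        funext j
        rw [← hz j, Tensor.map_quotientValue]
        simp
      have hinj : Function.Injective x := by
        intro i j hij
        by_contra hne
        refine right_ne_zero_of_mul hx ?_
        rw [map_prod]
        refine Finset.prod_eq_zero (Finset.mem_univ i) ?_
        rw [map_prod]
        exact Finset.prod_eq_zero (i := j) (by simp [Ne.symm hne]) (by simp [hij])
      subst hzx
      exact Tensor.exists_eigenvalueMap_eq m hm z hinj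
  let := symZariskiTopology (2 * m)
  refine ⟨⟨U, hUo, hUd, hUs⟩, Uᶜ, isClosed_compl_iff.mpr hUo, fun h => ?_, fun S hS => ?_⟩
  · obtain ⟨S, hS⟩ := hUn
    exact (h.symm ▸ Set.mem_univ S : S ∈ Uᶜ) hS
  · exact hUs (not_not.mp hS)
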